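/- Let $\alpha$ be an irrational real number. Let $a_1,a_2,\dots$ be the partial quotients of the negative ("round-up") continued fraction $$\{\alpha\}=\cfrac{1}{a_1-\cfrac{1}{a_2-\cfrac{1}{a_3-\cdots}}},$$ generated by $\alpha_0:=\{\alpha\}$ (the fractional part of $\alpha$), $a_{n+1}:=\lceil 1/\alpha_n\rceil$, $\alpha_{n+1}:=\lceil 1/\alpha_n\rceil-1/\alpha_n$ for $n\ge 0$, and let $R:=\liminf_{i\to\infty}a_i\in\{2,3,\dots\}\cup\{\infty\}$. For real $\gamma$ put $$M(\alpha,\gamma):=\liminf_{|n|\to\infty}|n|\,\|n\alpha-\gamma\|,\qquad \rho(\alpha):=\sup_{\gamma\in\mathbb R,\ \gamma\notin\mathbb Z+\mathbb Z\alpha}M(\alpha,\gamma),$$ where $n$ runs over the integers and $\|x\|$ is the distance from $x$ to the nearest integer. If $R$ is (finite and) odd, then $$\rho(\alpha)\le C(R):=\frac14\left(1-\frac1R\right)\left(1-\frac1{R^2}\right)=\frac14\left(1-\frac1R-\frac1{R^2}+\frac1{R^3}\right).$$ -/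

import Mathlib

open Filter

noncomputable section

namespace InhomApprox

/-- The complete quotients `α₀, α₁, α₂, …` of the negative ("round-up") continued fraction
algorithm: `α₀ = {α}` and `αₙ₊₁ = ⌈1/αₙ⌉ - 1/αₙ`. -/
def negRemainder (α : ℝ) : ℕ → ℝ
  | 0 => Int.fract α
  | n + 1 => (⌈1 / negRemainder α n⌉ : ℝ) - 1 / negRemainder α n

/-- The partial quotients of `{α} = [0; a₁, a₂, …]⁻`, indexed from `0`:
`negPartialQuotient α n` is `aₙ₊₁ = ⌈1/αₙ⌉`.  For irrational `α` every `αₙ` lies in `(0,1)`, so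
the natural-number ceiling is the usual one. -/
def negPartialQuotient (α : ℝ) (n : ℕ) : ℕ := ⌈1 / negRemainder α n⌉₊

/-- `liminf aᵢ`, in `ℕ ∪ {∞}`; the value `∞` means `aᵢ → ∞`. -/
def liminfPartialQuotient (α : ℝ) : ℕ∞ :=
  liminf (fun n : ℕ => (negPartialQuotient α n : ℕ∞)) atTop

/-- The distance from `x` to the nearest integer. -/
def distNearestInt (x : ℝ) : ℝ := |x - round x|

/-- `M(α,γ) = liminf_{|n| → ∞} |n| ‖nα - γ‖`, in the extended reals.  On the integers,
`|n| → ∞` is the cofinite filter. -/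
def inhomConst (α γ : ℝ) : EReal :=
  liminf (fun n : ℤ => ((|(n : ℝ)| * distNearestInt (n * α - γ) : ℝ) : EReal)) cofinite

/-- `ρ(α) = sup M(α,γ)` over the real `γ ∉ ℤ + ℤα`. -/
def worstInhomConst (α : ℝ) : EReal :=
  ⨆ γ ∈ {γ : ℝ | ¬ ∃ m n : ℤ, γ = m + n * α}, inhomConst α γ

/-- `C(R) = (1/4)(1 - 1/R)(1 - 1/R²)`. -/
def oddBound (R : ℕ) : ℝ := 1 / 4 * (1 - 1 / (R : ℝ)) * (1 - 1 / (R : ℝ) ^ 2)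

end InhomApprox

end

/-!
Let `a` be the value of the liminf, attained at infinitely many indices `k`, and let `v = (q, D)`
run through the lattice vectors `(n, nα - m)` produced by the algorithm, with consecutive vectors
related by `vₖ₊₂ = aₖ vₖ₊₁ - vₖ` and spanning area one.  At an index with `aₖ = a`, rescale the two
axes so that `vₖ₊₁ = (1, 1)`; then `vₖ = (x, a - y)` and `vₖ₊₂ = (a - x, y)`, where
`x = qₖ / qₖ₊₁` and `y` is the next complete quotient, both at most `2/5` because `a ≥ 3`
eventually bounds the partial quotients from below.  It suffices to find in every translate of the
lattice spanned by `(1, 1)` and `(x, a - y)`, whose covolume is `Δ = a - x - y`, a point `(X, Y)`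
with `|X Y| ≤ C(a) Δ` and `Y` bounded (`exists_grid_point`).

The grid lies on lines `Y - X = const` at distance `Δ` apart.  Take the two lines on either side
of the origin, `Y - X = d ≥ 0` and `Y - X = -e < 0`, and on each of them the grid points next to
the two axes.  Let `p, p'` (first line) and `r, r'` (second line) be the distances, in `[0, 1)`, of
the points next to the vertical and horizontal axis, on the side of the quadrant cut by that line.
Then `p + r + x`, `p' + r' + y`, `d - p - p'` and `e - r - r'` are integers.

* If `p + r + x = 2`, the outer points at distances `1 - p` and `1 - r`, of sum `x`, give a small
  product (`min_mul_add_le`, `wrapped_bound`); likewise for `p' + r' + y = 2`.  If one of these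
  sums is `0`, there is a grid point on an axis.
* Otherwise `p + r = 1 - x` and `p' + r' = 1 - y`, so `d = p + p' + M` and `e = r + r' + N` with
  `M + N = a - 2`.  This is where the parity enters: `a` is odd, so `M ≠ N`, say `M < N`.  If
  `N = M + 1`, averaging the products of the inner points on each line leaves functions of
  `P = (p + p') / 2` alone, one increasing and one decreasing, whose common value divided by `Δ` is
  largest at `x = y = 0`, where it is `C(a)` (`balanced_case`).  If `N ≥ M + 3`, the first line
  alone has a point with a small product (`unbalanced_case`).

Since `|nα - m - γ| = Dₖ₊₁ |Y|` tends to `0` along the points found while `γ ∉ ℤ + ℤα`,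
infinitely many integers `n` occur.
-/

open Filter

namespace InhomApprox

/-! ### Numerical inequalities -/

lemma oddBound_lower {a : ℕ} (ha : 3 ≤ a) : 4 / 27 ≤ oddBound a := by
  have h : (3 : ℝ) ≤ a := by exact_mod_cast ha
  have h3 : 1 / (a : ℝ) ≤ 1 / 3 := one_div_le_one_div_of_le (by norm_num) h
  have h0 : 0 < 1 / (a : ℝ) := by positivity
  unfold oddBound
  rw [← one_div_pow]
  set g := 1 / (a : ℝ)
  have h2 : g ^ 2 ≤ 1 / 9 := by nlinarith
  nlinarith [mul_nonneg (sub_nonneg.2 h3) (sub_nonneg.2 h2)]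

/-- The hypothesis bounds the convex combination of `P * (P + d)` and `Q * (Q + e)` with weights
proportional to `Q` and `P`, which equals `P * Q * (P + Q + (d + e)) / (P + Q)`. -/
lemma min_mul_add_le {P Q d e B : ℝ} (hP : 0 ≤ P) (hQ : 0 ≤ Q)
    (hB : (P + Q) * (P + Q + (d + e)) ≤ 4 * B) (h0 : 0 ≤ P + Q + (d + e)) :
    P * (P + d) ≤ B ∨ Q * (Q + e) ≤ B := by
  by_contra! h
  obtain ⟨h1, h2⟩ := h
  have hB0 : 0 ≤ B := by
    have := mul_nonneg (add_nonneg hP hQ) h0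
    linarith
  have hP' : 0 < P := by
    rcases hP.eq_or_lt with h | h
    · rw [← h] at h1; linarith
    · exact h
  have hQ' : 0 < Q := by
    rcases hQ.eq_or_lt with h | h
    · rw [← h] at h2; linarith
    · exact h
  have e1 : Q * B < Q * (P * (P + d)) := mul_lt_mul_of_pos_left h1 hQ'
  have e2 : P * B < P * (Q * (Q + e)) := mul_lt_mul_of_pos_left h2 hP'
  have e3 : (P + Q) * (4 * B) < (P + Q) * ((P + Q) * (P + Q + (d + e))) := by
    nlinarith [mul_nonneg (sq_nonneg (P - Q)) h0]
  exact absurd (lt_of_mul_lt_mul_left e3 (by positivity)) (not_lt.2 hB)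

/-- Supplies the hypothesis of `min_mul_add_le` for `P + Q = x` and `d + e = a - x - y`. -/
lemma wrapped_bound {a : ℕ} (ha : 3 ≤ a) {x y : ℝ} (hx : x ≤ 2 / 5) (hy : y ≤ 2 / 5) :
    x * (x + (a - x - y)) ≤ 4 * (oddBound a * (a - x - y)) := by
  have h : (3 : ℝ) ≤ a := by exact_mod_cast ha
  have := oddBound_lower ha
  nlinarith [mul_nonneg (sub_nonneg.2 this) (show (0 : ℝ) ≤ a - x - y by linarith),
    mul_nonneg (sub_nonneg.2 hx) (show (0 : ℝ) ≤ a - y by linarith)]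

/-- The value at which the two families in `balanced_case` balance, relative to the covolume
`a - 2 * s`, is largest at `s = 0`. -/
lemma balanced_value_le {a s : ℝ} (ha : 3 ≤ a) (hs0 : 0 ≤ s) (hs : s ≤ 2 / 5) :
    (1 + s * (1 / (a - 2 * s)) - (1 - s) * (1 / (a - 2 * s)) ^ 2) * (1 - s) *
      (1 - 1 / (a - 2 * s)) ≤ (1 - 1 / a ^ 2) * (1 - 1 / a) := by
  have hA : 0 < a - 2 * s := by linarith
  have h1 : 1 / (a - 2 * s) ≤ 1 / 2 := one_div_le_one_div_of_le (by norm_num) (by linarith)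
  have h2 : 1 / a ≤ 1 / (a - 2 * s) := one_div_le_one_div_of_le hA (by linarith)
  have h3 : 1 / a ≤ 1 / 3 := one_div_le_one_div_of_le (by norm_num) ha
  have h4 : 0 < 1 / a := by positivity
  rw [← one_div_pow]
  set h := 1 / (a - 2 * s)
  set g := 1 / a
  have hg2 : g ^ 2 ≤ 1 / 9 := by nlinarith
  have hgh : g ^ 2 ≤ h ^ 2 := by gcongr
  have key : (1 + s * h - (1 - s) * h ^ 2) * (1 - s) ≤ 1 - g ^ 2 := by
    have e1 : (1 - s) * (1 + s * h) ≤ (1 - s) * (1 + s * (1 / 2)) := by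
      gcongr; linarith
    have e2 : (1 - s) ^ 2 * g ^ 2 ≤ (1 - s) ^ 2 * h ^ 2 := by gcongr
    have e3 : (2 * s - s ^ 2) * g ^ 2 ≤ (2 * s - s ^ 2) * (1 / 9) := by
      gcongr
      nlinarith
    nlinarith
  apply mul_le_mul key (by linarith) (by linarith)
  nlinarith

/-- The extremal case: the two lines have offsets `p + p' + m` and `r + r' + m + 1`. Equality holds
for `x = y = 0` and `p = p' = (1 + 1 / a) / 2`. -/
lemma balanced_case {a m : ℕ} (ha : a = 2 * m + 3) {x y p p' r r' : ℝ} (hx0 : 0 ≤ x)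
    (hx : x ≤ 2 / 5) (hy0 : 0 ≤ y) (hy : y ≤ 2 / 5) (hp : 0 ≤ p) (hp' : 0 ≤ p') (hr : 0 ≤ r)
    (hr' : 0 ≤ r') (h : p + r = 1 - x) (h' : p' + r' = 1 - y) :
    (p * (p' + m) ≤ oddBound a * (a - x - y) ∨ p' * (p + m) ≤ oddBound a * (a - x - y)) ∨
    (r * (r' + (m + 1)) ≤ oddBound a * (a - x - y) ∨
      r' * (r + (m + 1)) ≤ oddBound a * (a - x - y)) := by
  by_contra! hc
  obtain ⟨⟨c1, c2⟩, c3, c4⟩ := hc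
  have ham : (a : ℝ) = 2 * m + 3 := by rw [ha]; push_cast; ring
  have hm : (0 : ℝ) ≤ m := Nat.cast_nonneg m
  obtain ⟨s, hs⟩ : ∃ s, s = (x + y) / 2 := ⟨_, rfl⟩
  obtain ⟨P, hP⟩ : ∃ P, P = (p + p') / 2 := ⟨_, rfl⟩
  obtain ⟨Q, hQ⟩ : ∃ Q, Q = (r + r') / 2 := ⟨_, rfl⟩
  have hPQ : P + Q = 1 - s := by rw [hP, hQ, hs]; linarith
  have hP0 : 0 ≤ P := by rw [hP]; positivity
  have hQ0 : 0 ≤ Q := by rw [hQ]; positivity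
  have hs0 : 0 ≤ s := by rw [hs]; positivity
  have hs1 : s ≤ 2 / 5 := by rw [hs]; linarith
  have d1 : oddBound a * (a - x - y) < P * (P + m) := by
    rw [hP]; linarith [sq_nonneg (p - p')]
  have d2 : oddBound a * (a - x - y) < Q * (Q + (m + 1)) := by
    rw [hQ]; linarith [sq_nonneg (r - r')]
  have hA : 0 < (a : ℝ) - 2 * s := by linarith
  obtain ⟨A, hAd⟩ : ∃ A, A = (a : ℝ) - 2 * s := ⟨_, rfl⟩
  have hxy : (a : ℝ) - x - y = A := by rw [hAd, hs]; ring
  have bv := balanced_value_le (a := a) (by linarith) hs0 hs1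
  rw [← hAd] at bv hA
  have hA1 : 1 / A * A = 1 := by field_simp
  obtain ⟨B, hB⟩ : ∃ B, B = 1 / A := ⟨_, rfl⟩
  rw [← hB] at bv hA1
  have hB0 : 0 < B := by rw [hB]; positivity
  have hB1 : B ≤ 1 := by
    rw [hB, div_le_one hA]; linarith
  have hmA : (m : ℝ) = (A + 2 * s - 3) / 2 := by linarith
  -- `P * (P + m)` and `Q * (Q + (m + 1))` agree when `P = (1 - s) * (1 + B) / 2`, where
  -- `Q = (1 - s) * (1 - B) / 2`.
  have val : (1 - s) * (1 - B) / 2 * ((1 - s) * (1 - B) / 2 + (m + 1)) ≤ oddBound a * A := by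
    have e : (1 - s) * (1 - B) / 2 * ((1 - s) * (1 - B) / 2 + (m + 1)) =
        1 / 4 * ((1 + s * B - (1 - s) * B ^ 2) * (1 - s) * (1 - B)) * A := by
      rw [hmA]
      linear_combination (1 - s) * (1 - B) / 4 * (-s + (1 - s) * B) * hA1
    rw [e]
    unfold oddBound
    have := mul_le_mul_of_nonneg_right bv hA.le
    linarith
  have val' : (1 - s) * (1 + B) / 2 * ((1 - s) * (1 + B) / 2 + m) ≤ oddBound a * A := by
    have e : (1 - s) * (1 + B) / 2 * ((1 - s) * (1 + B) / 2 + m) =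
        (1 - s) * (1 - B) / 2 * ((1 - s) * (1 - B) / 2 + (m + 1)) := by
      rw [hmA]
      linear_combination (1 - s) / 2 * hA1
    rw [e]; exact val
  rw [hxy] at d1 d2
  rcases le_total P ((1 - s) * (1 + B) / 2) with hle | hle
  · have : P * (P + m) ≤ (1 - s) * (1 + B) / 2 * ((1 - s) * (1 + B) / 2 + m) :=
      mul_le_mul hle (by linarith) (by linarith) (hP0.trans hle)
    linarith
  · have hle' : Q ≤ (1 - s) * (1 - B) / 2 := by linarith
    have : Q * (Q + (m + 1)) ≤ (1 - s) * (1 - B) / 2 * ((1 - s) * (1 - B) / 2 + (m + 1)) :=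
      mul_le_mul hle' (by linarith) (by linarith) (hQ0.trans hle')
    linarith

/-- If the line with the smaller offset `p + p' + M` has `M ≤ m - 1`, then one of its two grid
points next to the vertical axis has a small product. For `M = -1` the inner point may lie beyond
the horizontal axis, whence the absolute value. -/
lemma unbalanced_case {a m : ℕ} (ha : a = 2 * m + 3) {M : ℤ} (hM : -1 ≤ M) (hMm : M + 1 ≤ m)
    {x y p p' : ℝ} (hx : x ≤ 2 / 5) (hy : y ≤ 2 / 5) (hp : 0 ≤ p) (hp' : 0 ≤ p')
    (hp1 : p ≤ 1) (hp1' : p' ≤ 1) :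
    p * |p' + M| ≤ oddBound a * (a - x - y) ∨
      (1 - p) * (1 + M + p') ≤ oddBound a * (a - x - y) := by
  have ham : (a : ℝ) = 2 * m + 3 := by rw [ha]; push_cast; ring
  have hm : (0 : ℝ) ≤ m := Nat.cast_nonneg m
  have hMm' : (M : ℝ) + 1 ≤ m := by exact_mod_cast hMm
  have hob := oddBound_lower (a := a) (by omega)
  by_contra! hc
  obtain ⟨c1, c2⟩ := hc
  rcases hM.eq_or_lt with h | h
  · rw [← h] at c1 c2
    push_cast at c1 c2
    rw [abs_of_nonpos (by linarith)] at c1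
    have hK : 1 / 4 ≤ oddBound a * (a - x - y) := by nlinarith
    -- The product of `p * (1 - p')` and `(1 - p) * p'` is at most `1 / 16`.
    nlinarith [sq_nonneg (p - 1/2), sq_nonneg (p' - 1/2), mul_nonneg hp hp']
  · have hM0 : (0 : ℝ) ≤ M := by exact_mod_cast (by omega : 0 ≤ M)
    rw [abs_of_nonneg (by linarith)] at c1
    have hK : ((M : ℝ) + 3 / 2) / 2 ≤ oddBound a * (a - x - y) := by
      have h3 : (3 : ℝ) ≤ a := by linarith
      have e : oddBound a * (a - 4 / 5) ≤ oddBound a * (a - x - y) := by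
        exact mul_le_mul_of_nonneg_left (by linarith) (by linarith)
      have e2 : ((a : ℝ) - 2) / 4 ≤ oddBound a * (a - 4 / 5) := by
        have : oddBound a * (a - 4 / 5) - ((a : ℝ) - 2) / 4
          = (1 / 20 * a ^ 3 + 1/4 * a ^ 2 * (- 1 / 5) + 1/4 * a * (9 / 5)- 1 / 5) / a ^ 3 := by
          unfold oddBound
          field_simp
          ring
        have : 0 ≤ oddBound a * (a - 4 / 5) - ((a : ℝ) - 2) / 4 := by
          rw [this]
          apply div_nonneg _ (by positivity)
          nlinarith [sq_nonneg (a : ℝ)]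
        linarith
      linarith
    -- Adding `c1` and `c2` forces `p < 1 / 2`, and then `c1` fails.
    have hp2 : p < 1 / 2 := by linarith
    have : p * (p' + M) ≤ 1 / 2 * (p' + M) := by gcongr
    linarith

/-! ### Grid points near the axes -/

/-- The case `p + r = 1 - x`, `p' + r' = 1 - y`, when the first line has the smaller offset. The
offsets are `p + p' + M` and `r + r' + (a - 2 - M)`. -/
lemma exists_small_of_offset_le {a m : ℕ} (ha : a = 2 * m + 3) {M : ℤ} (hM : -1 ≤ M) (hMm : M ≤ m)
    {x y p p' r r' : ℝ} (hx0 : 0 ≤ x)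
    (hx : x ≤ 2 / 5) (hy0 : 0 ≤ y) (hy : y ≤ 2 / 5) (hp : 0 ≤ p) (hp' : 0 ≤ p') (hr : 0 ≤ r)
    (hr' : 0 ≤ r') (hp1 : p ≤ 1) (hp1' : p' ≤ 1) (h : p + r = 1 - x) (h' : p' + r' = 1 - y) :
    (p * |p' + M| ≤ oddBound a * (a - x - y) ∨ p' * |p + M| ≤ oddBound a * (a - x - y)) ∨
    (1 - p) * (1 + M + p') ≤ oddBound a * (a - x - y) ∨
    (r * |r' + (2 * m + 1 - M)| ≤ oddBound a * (a - x - y) ∨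
      r' * |r + (2 * m + 1 - M)| ≤ oddBound a * (a - x - y)) := by
  rcases hMm.eq_or_lt with rfl | hlt
  · have hm : (0 : ℝ) ≤ m := Nat.cast_nonneg m
    have := balanced_case ha hx0 hx hy0 hy hp hp' hr hr' h h'
    have e : (2 * (m : ℝ) + 1 - ((m : ℤ) : ℝ)) = m + 1 := by push_cast; ring
    rw [e, Int.cast_natCast, abs_of_nonneg (by linarith), abs_of_nonneg (by linarith),
      abs_of_nonneg (by linarith), abs_of_nonneg (by linarith)]
    tauto
  · have := unbalanced_case ha hM hlt hx hy hp hp' hp1 hp1'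
    tauto

/-- Among the eight grid points next to the axes, on the two lines with offsets `d` and `-e`, one
has a small product. -/
lemma exists_small_vertex {a m : ℕ} (ha : a = 2 * m + 3) {x y p p' r r' d e : ℝ} (hx0 : 0 ≤ x)
    (hx : x ≤ 2 / 5) (hy0 : 0 ≤ y) (hy : y ≤ 2 / 5) (hp : 0 ≤ p) (hp' : 0 ≤ p') (hr : 0 ≤ r)
    (hr' : 0 ≤ r') (hp1 : p < 1) (hp1' : p' < 1) (hr1 : r < 1) (hr1' : r' < 1)
    (hd : 0 ≤ d) (he : 0 ≤ e) (hde : d + e = a - x - y)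
    (hpr : ∃ k : ℤ, p + r + x = k) (hpd : ∃ k : ℤ, d - p - p' = k)
    (hre : ∃ k : ℤ, e - r - r' = k) :
    (p * |d - p| ≤ oddBound a * (a - x - y) ∨ (1 - p) * (1 - p + d) ≤ oddBound a * (a - x - y) ∨
      p' * |d - p'| ≤ oddBound a * (a - x - y) ∨
      (1 - p') * (1 - p' + d) ≤ oddBound a * (a - x - y)) ∨
    (r * |e - r| ≤ oddBound a * (a - x - y) ∨ (1 - r) * (1 - r + e) ≤ oddBound a * (a - x - y) ∨
      r' * |e - r'| ≤ oddBound a * (a - x - y) ∨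
      (1 - r') * (1 - r' + e) ≤ oddBound a * (a - x - y)) := by
  obtain ⟨k, hk⟩ := hpr
  obtain ⟨M, hM⟩ := hpd
  obtain ⟨N, hN⟩ := hre
  have ha3 : 3 ≤ a := by omega
  have ham : (a : ℝ) = 2 * m + 3 := by rw [ha]; push_cast; ring
  have hk' : p' + r' + y = ((2 * m + 3 - M - N - k : ℤ) : ℝ) := by push_cast; linarith
  -- The sums `k = p + r + x` and `l = p' + r' + y` can only be `0`, `1` or `2`.
  obtain ⟨l, hl⟩ : ∃ l : ℤ, l = 2 * m + 3 - M - N - k := ⟨_, rfl⟩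
  rw [← hl] at hk'
  have hK : 0 ≤ oddBound a * (a - x - y) := by
    have := oddBound_lower ha3
    exact mul_nonneg (by linarith) (by linarith)
  have k0 : 0 ≤ k := by
    have : (0 : ℝ) ≤ k := by linarith
    exact_mod_cast this
  have l0 : 0 ≤ l := by
    have : (0 : ℝ) ≤ l := by linarith
    exact_mod_cast this
  have k3 : k < 3 := by
    have : (k : ℝ) < 3 := by linarith
    exact_mod_cast this
  have l3 : l < 3 := by
    have : (l : ℝ) < 3 := by linarith
    exact_mod_cast this
  have hM1 : -2 < M := by
    have : (-2 : ℝ) < M := by linarith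
    exact_mod_cast this
  have hN1 : -2 < N := by
    have : (-2 : ℝ) < N := by linarith
    exact_mod_cast this
  obtain rfl | rfl | rfl : k = 0 ∨ k = 1 ∨ k = 2 := by omega
  · left; left
    have : p = 0 := by push_cast at hk; linarith
    rw [this, zero_mul]; exact hK
  · obtain rfl | rfl | rfl : l = 0 ∨ l = 1 ∨ l = 2 := by omega
    · left; right; right; left
      have : p' = 0 := by push_cast at hk'; linarith
      rw [this, zero_mul]; exact hK
    · have e1 : p + r = 1 - x := by push_cast at hk; linarith
      have e2 : p' + r' = 1 - y := by push_cast at hk'; linarith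
      have hMN : N = 2 * m + 1 - M := by omega
      have hMN' : (N : ℝ) = 2 * m + 1 - M := by rw [hMN]; push_cast; ring
      have f1 : d - p = p' + M := by linarith
      have f2 : d - p' = p + M := by linarith
      have f3 : e - r = r' + N := by linarith
      have f4 : e - r' = r + N := by linarith
      have f5 : 1 - p + d = 1 + M + p' := by linarith
      have f6 : 1 - r + e = 1 + N + r' := by linarith
      rw [f1, f2, f3, f4, f5, f6]
      rcases le_total M m with h | h
      · have := exists_small_of_offset_le ha (by omega) h hx0 hx hy0 hy hp hp' hr hr' hp1.le
          hp1'.le e1 e2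
        rw [← hMN'] at this
        tauto
      · rcases h.eq_or_lt with h | h
        · have := exists_small_of_offset_le ha (by omega) h.symm.le hx0 hx hy0 hy hp hp'
            hr hr' hp1.le hp1'.le e1 e2
          rw [← hMN'] at this
          tauto
        · have := exists_small_of_offset_le ha (M := N) (by omega) (by omega) hx0 hx hy0 hy hr
            hr' hp hp'
            hr1.le hr1'.le (by linarith) (by linarith)
          have e : (2 * (m : ℝ) + 1 - N) = M := by linarith
          rw [e] at this
          tauto
    · have e1 : (1 - p') + (1 - r') = y := by push_cast at hk'; linarith
      have := min_mul_add_le (P := 1 - p') (Q := 1 - r') (d := d) (e := e)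
        (B := oddBound a * (a - x - y)) (by linarith) (by linarith)
        (by rw [e1, hde]
            have := wrapped_bound ha3 hy hx
            rwa [sub_right_comm (a : ℝ) y x] at this) (by linarith)
      tauto
  · have e1 : (1 - p) + (1 - r) = x := by push_cast at hk; linarith
    have := min_mul_add_le (P := 1 - p) (Q := 1 - r) (d := d) (e := e)
      (B := oddBound a * (a - x - y)) (by linarith) (by linarith)
      (by rw [e1, hde]; exact wrapped_bound ha3 hx hy) (by linarith)
    tauto

/-- Every translate of the lattice spanned by `(1, 1)` and `(x, a - y)` has a point, not too far
from the first axis, whose coordinates have product at most `oddBound a` times the covolume. -/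
lemma exists_grid_point {a m : ℕ} (ha : a = 2 * m + 3) {x y : ℝ} (hx0 : 0 ≤ x)
    (hx : x ≤ 2 / 5) (hy0 : 0 ≤ y) (hy : y ≤ 2 / 5) (X Y : ℝ) :
    ∃ i j : ℤ, |X + i + j * x| * |Y + i + j * (a - y)| ≤ oddBound a * (a - x - y) ∧
      |Y + i + j * (a - y)| ≤ a + 1 := by
  have ham : (a : ℝ) = 2 * m + 3 := by rw [ha]; push_cast; ring
  have hm : (0 : ℝ) ≤ m := Nat.cast_nonneg m
  obtain ⟨D, hD⟩ : ∃ D, D = (a : ℝ) - x - y := ⟨_, rfl⟩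
  have hD0 : 0 < D := by linarith
  -- The line `j` is the first one with `Y - X ≥ 0`; the line `j - 1` lies below the origin.
  obtain ⟨j, hj, -⟩ := existsUnique_add_zsmul_mem_Ico hD0 (Y - X) 0
  obtain ⟨hj0, hj1⟩ := hj
  rw [zsmul_eq_mul] at hj0 hj1
  obtain ⟨d, hd⟩ : ∃ d, d = Y - X + j * D := ⟨_, rfl⟩
  rw [← hd] at hj0 hj1
  obtain ⟨p, hp⟩ : ∃ p, p = Int.fract (-(X + j * x)) := ⟨_, rfl⟩
  obtain ⟨p', hp'⟩ : ∃ p, p = Int.fract (Y + j * (a - y)) := ⟨_, rfl⟩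
  obtain ⟨r, hr⟩ : ∃ p, p = Int.fract (X + (j - 1) * x) := ⟨_, rfl⟩
  obtain ⟨r', hr'⟩ : ∃ p, p = Int.fract (-(Y + (j - 1) * (a - y))) := ⟨_, rfl⟩
  obtain ⟨k1, hk1⟩ : ∃ k : ℤ, p = -(X + j * x) - k := ⟨_, hp⟩
  obtain ⟨k2, hk2⟩ : ∃ k : ℤ, p' = (Y + j * (a - y)) - k := ⟨_, hp'⟩
  obtain ⟨k3, hk3⟩ : ∃ k : ℤ, r = (X + (j - 1) * x) - k := ⟨_, hr⟩
  obtain ⟨k4, hk4⟩ : ∃ k : ℤ, r' = -(Y + (j - 1) * (a - y)) - k := ⟨_, hr'⟩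
  have hp0 : 0 ≤ p := hp ▸ Int.fract_nonneg _
  have hp1 : p < 1 := hp ▸ Int.fract_lt_one _
  have hp0' : 0 ≤ p' := hp' ▸ Int.fract_nonneg _
  have hp1' : p' < 1 := hp' ▸ Int.fract_lt_one _
  have hr0 : 0 ≤ r := hr ▸ Int.fract_nonneg _
  have hr1 : r < 1 := hr ▸ Int.fract_lt_one _
  have hr0' : 0 ≤ r' := hr' ▸ Int.fract_nonneg _
  have hr1' : r' < 1 := hr' ▸ Int.fract_lt_one _
  have key := exists_small_vertex ha (d := d) (e := D - d) hx0 hx hy0 hy hp0 hp0' hr0 hr0' hp1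
    hp1' hr1 hr1' hj0 (by linarith) (by rw [hD]; ring)
    ⟨-k1 - k3, by rw [hk1, hk3]; push_cast; ring⟩
    ⟨k1 + k2, by rw [hk1, hk2, hd, hD]; push_cast; ring⟩
    ⟨k3 + k4, by rw [hk3, hk4, hd, hD]; push_cast; ring⟩
  clear hp hp' hr hr'
  have fin : ∀ (i j : ℤ) (U V : ℝ), X + i + j * x = U → Y + i + j * (a - y) = V →
      |U| * |V| ≤ oddBound a * (a - x - y) → |V| ≤ a + 1 →
      ∃ i j : ℤ, |X + i + j * x| * |Y + i + j * (a - y)| ≤ oddBound a * (a - x - y) ∧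
      |Y + i + j * (a - y)| ≤ a + 1 := by
    intro i j U V hU hV h1 h2
    exact ⟨i, j, by rw [hU, hV]; exact h1, by rw [hV]; exact h2⟩
  rcases key with (h | h | h | h) | (h | h | h | h)
  · refine fin k1 j (-p) (d - p) (by rw [hk1]; ring) (by rw [hk1, hd, hD]; ring) ?_
      (by rw [abs_le]; constructor <;> linarith)
    rwa [abs_neg, abs_of_nonneg hp0]
  · refine fin (k1 + 1) j (1 - p) (1 - p + d) (by rw [hk1]; push_cast; ring)
      (by rw [hk1, hd, hD]; push_cast; ring) ?_ (by rw [abs_le]; constructor <;> linarith)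
    rwa [abs_of_nonneg (by linarith), abs_of_nonneg (by linarith)]
  · refine fin (-k2) j (p' - d) p' (by rw [hk2, hd, hD]; push_cast; ring)
      (by rw [hk2]; push_cast; ring) ?_ (by rw [abs_le]; constructor <;> linarith)
    rwa [abs_sub_comm, abs_of_nonneg hp0', mul_comm]
  · refine fin (-k2 - 1) j (-(1 - p' + d)) (-(1 - p')) (by rw [hk2, hd, hD]; push_cast; ring)
      (by rw [hk2]; push_cast; ring) ?_ (by rw [abs_le]; constructor <;> linarith)
    rwa [abs_neg, abs_neg, abs_of_nonneg (by linarith), abs_of_nonneg (by linarith), mul_comm]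
  · refine fin (-k3) (j - 1) r (-(D - d - r)) (by rw [hk3]; push_cast; ring)
      (by rw [hk3, hd, hD]; push_cast; ring) ?_ (by rw [abs_le]; constructor <;> linarith)
    rwa [abs_neg, abs_of_nonneg hr0]
  · refine fin (-k3 - 1) (j - 1) (-(1 - r)) (-(1 - r + (D - d))) (by rw [hk3]; push_cast; ring)
      (by rw [hk3, hd, hD]; push_cast; ring) ?_ (by rw [abs_le]; constructor <;> linarith)
    rwa [abs_neg, abs_neg, abs_of_nonneg (by linarith), abs_of_nonneg (by linarith)]
  · refine fin k4 (j - 1) (D - d - r') (-r') (by rw [hk4, hd, hD]; push_cast; ring)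
      (by rw [hk4]; push_cast; ring) ?_ (by rw [abs_le]; constructor <;> linarith)
    rwa [abs_neg, abs_of_nonneg hr0', mul_comm]
  · refine fin (k4 + 1) (j - 1) (1 - r' + (D - d)) (1 - r')
      (by rw [hk4, hd, hD]; push_cast; ring)
      (by rw [hk4]; push_cast; ring) ?_ (by rw [abs_le]; constructor <;> linarith)
    rwa [abs_of_nonneg (by linarith), abs_of_nonneg (by linarith), mul_comm]

/-! ### Convergents of the negative continued fraction -/

lemma negRemainder_mem {α : ℝ} (hα : Irrational α) (n : ℕ) :
    Irrational (negRemainder α n) ∧ 0 < negRemainder α n ∧ negRemainder α n < 1 := by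
  have base : ∀ z : ℝ, Irrational z → 0 ≤ z → z < 1 → Irrational z ∧ 0 < z ∧ z < 1 :=
    fun z hz h0 h1 => ⟨hz, lt_of_le_of_ne h0 hz.ne_zero.symm, h1⟩
  induction n with
  | zero =>
    exact base _ (by rw [negRemainder, Int.fract]; exact hα.sub_intCast _) (Int.fract_nonneg _)
      (Int.fract_lt_one _)
  | succ n ih =>
    refine base _ ?_ ?_ ?_
    · rw [negRemainder, one_div]
      exact ih.1.inv.intCast_sub _
    · rw [negRemainder]
      linarith [Int.le_ceil (1 / negRemainder α n)]
    · rw [negRemainder]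
      linarith [Int.ceil_lt_add_one (1 / negRemainder α n)]

lemma one_div_negRemainder {α : ℝ} (hα : Irrational α) (n : ℕ) :
    1 / negRemainder α n = negPartialQuotient α n - negRemainder α (n + 1) := by
  have h := (negRemainder_mem hα n).2.1
  rw [negRemainder, negPartialQuotient, natCast_ceil_eq_intCast_ceil (by positivity)]
  ring

lemma two_le_negPartialQuotient {α : ℝ} (hα : Irrational α) (n : ℕ) :
    2 ≤ negPartialQuotient α n := by
  obtain ⟨-, h0, h1⟩ := negRemainder_mem hα n
  have : 1 < ⌈1 / negRemainder α n⌉₊ := by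
    rw [Nat.lt_ceil, Nat.cast_one]
    exact one_lt_one_div h0 h1
  exact this

/-- The denominators of the convergents of the negative continued fraction, indexed so that
`negDenom α 0 = 0` belongs to the formal convergent `-1/0`. -/
noncomputable def negDenom (α : ℝ) : ℕ → ℤ
  | 0 => 0
  | 1 => 1
  | n + 2 => negPartialQuotient α n * negDenom α (n + 1) - negDenom α n

/-- The linear forms `qₙ α + pₙ > 0` at the denominators `qₙ = negDenom α n` (see
`exists_negDiff_eq`), defined as products of complete quotients. -/
noncomputable def negDiff (α : ℝ) : ℕ → ℝ
  | 0 => 1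
  | n + 1 => negRemainder α n * negDiff α n

lemma negDiff_pos {α : ℝ} (hα : Irrational α) (n : ℕ) : 0 < negDiff α n := by
  induction n with
  | zero => exact one_pos
  | succ n ih => exact mul_pos (negRemainder_mem hα n).2.1 ih

lemma negDiff_eq {α : ℝ} (hα : Irrational α) (n : ℕ) :
    negDiff α n = (negPartialQuotient α n - negRemainder α (n + 1)) * negDiff α (n + 1) := by
  rw [← one_div_negRemainder hα, negDiff, ← mul_assoc, one_div_mul_cancel, one_mul]
  exact (negRemainder_mem hα n).1.ne_zero

lemma negDiff_add_two {α : ℝ} (hα : Irrational α) (n : ℕ) :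
    negDiff α (n + 2) = negPartialQuotient α n * negDiff α (n + 1) - negDiff α n := by
  rw [negDiff_eq hα n, negDiff]
  ring

lemma exists_negDiff_eq {α : ℝ} (hα : Irrational α) (n : ℕ) :
    ∃ p : ℤ, negDiff α n = negDenom α n * α + p := by
  induction n using Nat.twoStepInduction with
  | zero => exact ⟨1, by simp [negDiff, negDenom]⟩
  | one => exact ⟨-⌊α⌋, by simp [negDiff, negDenom, negRemainder, Int.fract, sub_eq_add_neg]⟩
  | more n ih1 ih2 =>
    obtain ⟨p, hp⟩ := ih1
    obtain ⟨p', hp'⟩ := ih2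
    refine ⟨negPartialQuotient α n * p' - p, ?_⟩
    rw [negDiff_add_two hα, hp, hp', negDenom]
    push_cast
    ring

lemma negDenom_lt_succ {α : ℝ} (hα : Irrational α) (n : ℕ) :
    0 ≤ negDenom α n ∧ negDenom α n < negDenom α (n + 1) := by
  induction n with
  | zero => simp [negDenom]
  | succ n ih =>
    refine ⟨by omega, ?_⟩
    have h : (2 : ℤ) ≤ negPartialQuotient α n := by
      exact_mod_cast two_le_negPartialQuotient hα n
    rw [negDenom]
    nlinarith

lemma le_negDenom {α : ℝ} (hα : Irrational α) (n : ℕ) : (n : ℤ) ≤ negDenom α n := by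
  induction n with
  | zero => simp [negDenom]
  | succ n ih =>
    have := (negDenom_lt_succ hα n).2
    push_cast
    omega

/-- Consecutive lattice vectors `(qₙ, Dₙ)` span area one. -/
lemma negDenom_mul_negDiff_sub {α : ℝ} (hα : Irrational α) (n : ℕ) :
    negDenom α (n + 1) * negDiff α n - negDenom α n * negDiff α (n + 1) = 1 := by
  induction n with
  | zero => simp [negDenom, negDiff]
  | succ n ih =>
    rw [negDiff_add_two hα, negDenom, ← ih]
    push_cast
    ring

/-- The ratio `qₙ / qₙ₊₁` of consecutive denominators. -/
noncomputable def negRatio (α : ℝ) (n : ℕ) : ℝ := negDenom α n / negDenom α (n + 1)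

lemma negDenom_succ_pos {α : ℝ} (hα : Irrational α) (n : ℕ) : (0 : ℝ) < negDenom α (n + 1) := by
  have := negDenom_lt_succ hα n
  exact_mod_cast this.1.trans_lt this.2

lemma negRatio_nonneg {α : ℝ} (hα : Irrational α) (n : ℕ) : 0 ≤ negRatio α n :=
  div_nonneg (by exact_mod_cast (negDenom_lt_succ hα n).1) (negDenom_succ_pos hα n).le

lemma negRatio_lt_one {α : ℝ} (hα : Irrational α) (n : ℕ) : negRatio α n < 1 := by
  rw [negRatio, div_lt_one (negDenom_succ_pos hα n)]
  exact_mod_cast (negDenom_lt_succ hα n).2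

lemma negRatio_succ {α : ℝ} (hα : Irrational α) (n : ℕ) :
    negRatio α (n + 1) = 1 / (negPartialQuotient α n - negRatio α n) := by
  have h := (negDenom_succ_pos hα n).ne'
  rw [negRatio, negRatio, negDenom]
  push_cast
  rw [sub_div' h, one_div_div]

lemma negRemainder_eq {α : ℝ} (hα : Irrational α) (n : ℕ) :
    negRemainder α n = 1 / (negPartialQuotient α n - negRemainder α (n + 1)) := by
  rw [← one_div_negRemainder hα, one_div_one_div]

lemma one_div_sub_le_half {a : ℕ} (ha : 3 ≤ a) {z : ℝ} (hz : z ≤ 1) :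
    1 / ((a : ℝ) - z) ≤ 1 / 2 := by
  have : (3 : ℝ) ≤ a := by exact_mod_cast ha
  exact one_div_le_one_div_of_le (by norm_num) (by linarith)

lemma one_div_sub_le_two_fifths {a : ℕ} (ha : 3 ≤ a) {z : ℝ} (hz : z ≤ 1 / 2) :
    1 / ((a : ℝ) - z) ≤ 2 / 5 := by
  have : (3 : ℝ) ≤ a := by exact_mod_cast ha
  rw [div_le_iff₀ (by linarith)]
  linarith

lemma tendsto_negDiff {α : ℝ} (hα : Irrational α)
    (h : ∀ᶠ n in atTop, 3 ≤ negPartialQuotient α n) :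
    Tendsto (negDiff α) atTop (nhds 0) := by
  have hlim : Tendsto (fun n : ℕ => 2 * (1 / ((n : ℝ) + 1))) atTop (nhds 0) := by
    simpa using tendsto_one_div_add_atTop_nhds_zero_nat (𝕜 := ℝ).const_mul 2
  refine squeeze_zero' (Eventually.of_forall fun n => (negDiff_pos hα n).le) ?_ hlim
  filter_upwards [h] with n hn
  have hq := negDenom_succ_pos hα n
  have hrem : negRemainder α n ≤ 1 / 2 := by
    rw [negRemainder_eq hα]
    exact one_div_sub_le_half hn (negRemainder_mem hα _).2.2.le
  have hD := negDiff_pos hα n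
  have hdet := negDenom_mul_negDiff_sub hα n
  have hqn : (negDenom α n : ℝ) ≤ negDenom α (n + 1) := by
    exact_mod_cast (negDenom_lt_succ hα n).2.le
  have hle : ((n : ℝ) + 1) ≤ negDenom α (n + 1) := by
    have := le_negDenom hα (n + 1)
    exact_mod_cast this
  have h1 : (negDenom α n : ℝ) * negDiff α (n + 1) ≤
      negDenom α (n + 1) * (1 / 2 * negDiff α n) := by
    rw [negDiff]
    have := (negRemainder_mem hα n).2.1
    gcongr
  have h2 : ((n : ℝ) + 1) * negDiff α n ≤ negDenom α (n + 1) * negDiff α n := by gcongr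
  rw [mul_one_div, le_div_iff₀ (by positivity)]
  linarith

/-! ### Inhomogeneous approximation -/

/-- `exists_grid_point`, rescaled by `(qₖ₊₁, Dₖ₊₁)` and applied to the grid `(n, nα - m - γ)`. -/
lemma exists_int_mul_distNearestInt_le {α : ℝ} (hα : Irrational α) {R m k : ℕ}
    (hR : R = 2 * m + 3) (hk : negPartialQuotient α k = R) (hx : negRatio α k ≤ 2 / 5)
    (hy : negRemainder α (k + 1) ≤ 2 / 5) (γ : ℝ) :
    ∃ n : ℤ, |(n : ℝ)| * distNearestInt (n * α - γ) ≤ oddBound R ∧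
      distNearestInt (n * α - γ) ≤ (R + 1) * negDiff α (k + 1) := by
  have hD := negDiff_pos hα (k + 1)
  have hq := negDenom_succ_pos hα k
  have hdet := negDenom_mul_negDiff_sub hα k
  obtain ⟨i, j, h1, h2⟩ := exists_grid_point hR (negRatio_nonneg hα k) hx
    (negRemainder_mem hα (k + 1)).2.1.le hy 0 (-γ / negDiff α (k + 1))
  have hDk := negDiff_eq hα k
  rw [hk] at hDk
  have hx' : negRatio α k * negDenom α (k + 1) = negDenom α k := by
    rw [negRatio, div_mul_cancel₀ _ hq.ne']
  obtain ⟨p, hp⟩ := exists_negDiff_eq hα k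
  obtain ⟨p', hp'⟩ := exists_negDiff_eq hα (k + 1)
  set x := negRatio α k
  set y := negRemainder α (k + 1)
  set D := negDiff α (k + 1)
  set q : ℝ := (negDenom α (k + 1) : ℝ)
  obtain ⟨V, hV⟩ : ∃ V, V = -γ / D + i + j * (R - y) := ⟨_, rfl⟩
  rw [← hV] at h1 h2
  have hn : ((i * negDenom α (k + 1) + j * negDenom α k : ℤ) : ℝ) = q * (0 + i + j * x) := by
    push_cast
    rw [← hx']
    ring
  have hVD : D * V = (i * negDenom α (k + 1) + j * negDenom α k : ℤ) * α - γ -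
      ((-(i * p' + j * p) : ℤ) : ℝ) := by
    have e : D * V = -γ + i * D + j * negDiff α k := by
      rw [hV, hDk]
      field_simp
    rw [e, hp, hp']
    push_cast
    ring
  have hdist : distNearestInt ((i * negDenom α (k + 1) + j * negDenom α k : ℤ) * α - γ)
      ≤ D * |V| := by
    refine (round_le _ (-(i * p' + j * p))).trans ?_
    rw [← hVD, abs_mul, abs_of_pos hD]
  have hdet' : q * D * (R - x - y) = 1 := by
    rw [← hdet, hDk, ← hx']
    ring
  refine ⟨i * negDenom α (k + 1) + j * negDenom α k, ?_, ?_⟩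
  · calc _ ≤ |((i * negDenom α (k + 1) + j * negDenom α k : ℤ) : ℝ)| * (D * |V|) := by gcongr
      _ = q * D * (|0 + i + j * x| * |V|) := by
        rw [hn, abs_mul, abs_of_pos hq]
        ring
      _ ≤ q * D * (oddBound R * (R - x - y)) := by gcongr
      _ = oddBound R := by linear_combination oddBound R * hdet'
  · refine hdist.trans ?_
    rw [mul_comm]
    gcongr

lemma distNearestInt_pos {α γ : ℝ} (hγ : ¬ ∃ m n : ℤ, γ = m + n * α) (n : ℤ) :
    0 < distNearestInt (n * α - γ) := by
  rw [distNearestInt, abs_pos]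
  intro h
  exact hγ ⟨-round (n * α - γ), n, by push_cast; linarith⟩

lemma inhomConst_le {α : ℝ} (hα : Irrational α) {R : ℕ}
    (hR : liminfPartialQuotient α = (R : ℕ∞)) (hodd : Odd R) {γ : ℝ}
    (hγ : ¬ ∃ m n : ℤ, γ = m + n * α) :
    inhomConst α γ ≤ ((oddBound R : ℝ) : EReal) := by
  have hfreq : ∃ᶠ n in atTop, negPartialQuotient α n ≤ R := by
    have : liminf (fun n : ℕ => (negPartialQuotient α n : ℕ∞)) atTop < ((R + 1 : ℕ) : ℕ∞) := by
      rw [liminfPartialQuotient] at hR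
      rw [hR]
      exact_mod_cast Nat.lt_succ_self R
    refine (frequently_lt_of_liminf_lt (by isBoundedDefault) this).mono fun n hn => ?_
    exact Nat.lt_succ_iff.1 (by exact_mod_cast hn)
  have hR2 : 2 ≤ R := by
    obtain ⟨n, hn⟩ := hfreq.exists
    exact (two_le_negPartialQuotient hα n).trans hn
  have hev : ∀ᶠ n in atTop, R ≤ negPartialQuotient α n := by
    have : ((R - 1 : ℕ) : ℕ∞) < liminf (fun n : ℕ => (negPartialQuotient α n : ℕ∞)) atTop := by
      rw [liminfPartialQuotient] at hR
      rw [hR]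
      exact_mod_cast Nat.sub_lt (by omega) one_pos
    refine (eventually_lt_of_lt_liminf this (by isBoundedDefault)).mono fun n hn => ?_
    have : R - 1 < negPartialQuotient α n := by exact_mod_cast hn
    omega
  obtain ⟨m, hm⟩ : ∃ m, R = 2 * m + 3 := by
    obtain ⟨l, hl⟩ := hodd
    exact ⟨l - 1, by omega⟩
  have hev3 : ∀ᶠ n in atTop, 3 ≤ negPartialQuotient α n := hev.mono fun n hn => by omega
  obtain ⟨N, hN⟩ := eventually_atTop.1 hev3
  refine liminf_le_of_frequently_le' ?_
  rw [frequently_cofinite_iff_infinite]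
  intro hfin
  -- If only finitely many `n` satisfied the bound, `‖nα - γ‖` would be bounded below on them.
  have hsmall : ∀ᶠ k in atTop,
      ∀ n ∈ {n : ℤ | ((|(n : ℝ)| * distNearestInt (n * α - γ) : ℝ) : EReal) ≤
        ((oddBound R : ℝ) : EReal)},
      (R + 1) * negDiff α (k + 1) < distNearestInt (n * α - γ) := by
    rw [eventually_all_finite hfin]
    intro n _
    have := ((tendsto_negDiff hα hev3).comp (tendsto_add_atTop_nat 1)).const_mul ((R : ℝ) + 1)
    rw [mul_zero] at this
    exact this.eventually_lt_const (distNearestInt_pos hγ n)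
  obtain ⟨k, ⟨⟨hk1, hk2⟩, hk3⟩, hk4⟩ :=
    (((hfreq.and_eventually hev).and_eventually hsmall).and_eventually
      (eventually_ge_atTop (N + 2))).exists
  obtain ⟨k, rfl⟩ : ∃ j, k = j + 2 := ⟨k - 2, by omega⟩
  have hx : negRatio α (k + 2) ≤ 2 / 5 := by
    rw [negRatio_succ hα]
    refine one_div_sub_le_two_fifths (hN _ (by omega)) ?_
    rw [negRatio_succ hα]
    exact one_div_sub_le_half (hN _ (by omega)) (negRatio_lt_one hα _).le
  have hy : negRemainder α (k + 2 + 1) ≤ 2 / 5 := by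
    rw [negRemainder_eq hα]
    refine one_div_sub_le_two_fifths (hN _ (by omega)) ?_
    rw [negRemainder_eq hα]
    exact one_div_sub_le_half (hN _ (by omega)) (negRemainder_mem hα _).2.2.le
  obtain ⟨n, h1, h2⟩ := exists_int_mul_distNearestInt_le hα hm (le_antisymm hk1 hk2) hx hy γ
  exact absurd (hk3 n (EReal.coe_le_coe_iff.2 h1)) (not_lt.2 h2)

end InhomApprox

theorem theorem1 (α : ℝ) (hα : Irrational α) (R : ℕ)
    (hR : InhomApprox.liminfPartialQuotient α = (R : ℕ∞)) (hodd : Odd R) :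
    InhomApprox.worstInhomConst α ≤ ((InhomApprox.oddBound R : ℝ) : EReal) ∧
      InhomApprox.oddBound R =
        1 / 4 * (1 - 1 / (R : ℝ) - 1 / (R : ℝ) ^ 2 + 1 / (R : ℝ) ^ 3) := by
  refine ⟨iSup₂_le fun γ hγ => InhomApprox.inhomConst_le hα hR hodd hγ, ?_⟩
  rw [InhomApprox.oddBound, ← one_div_pow, ← one_div_pow]
  ring
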